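/- **Theorem (Duality Theorem for Layered Heyting Algebras).** A *layered Heyting algebra* is a Heyting algebra $A$ with binary operations $\blacktriangleright$, $-\!\blacktriangleright$, $\blacktriangleright\!-$ such that $a\blacktriangleright b\le c \iff a\le b\mathbin{-\!\blacktriangleright}c \iff b\le a\mathbin{\blacktriangleright\!-}c$; $\mathrm{LayHeyAlg}$ is the category of these algebras and the maps preserving all operations. An *Esakia space* is a compact topological space $X$ with a partial order $\preccurlyeq$ such that whenever $x\not\preccurlyeq y$ there is a clopen upward-closed set containing $x$ but not $y$, and such that the downward closure of every clopen set is clopen. Let $\mathcal C_\preccurlyeq(X)$ be the set of its clopen upward-closed sets. For a ternary relation $R$ on $X$ and $C,D\subseteq X$ put $$\begin{aligned}C\blacktriangleright_R D&=\{x\mid \exists w,y,z:\ w\preccurlyeq x,\ Ryzw,\ y\in C,\ z\in D\},\\ C\mathbin{-\!\blacktriangleright_R} D&=\{x\mid \forall w,y,z:\ x\preccurlyeq w,\ Rwyz,\ y\in C\ \Rightarrow\ z\in D\},\\ C\mathbin{\blacktriangleright\!-_R} D&=\{x\mid \forall w,y,z:\ x\preccurlyeq w,\ Rywz,\ y\in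 C\ \Rightarrow\ z\in D\}.\end{aligned}$$ An *intuitionistic layered space* is an Esakia space $X$ with a ternary relation $R$ such that $\mathcal C_\preccurlyeq(X)$ is closed under these three operations and, whenever $Rxyz$ fails, there are $C,D\in\mathcal C_\preccurlyeq(X)$ with $x\in C$, $y\in D$, $z\notin C\blacktriangleright_R D$. A morphism $f:(X,R)\to(X',R')$ is a continuous *intuitionistic layered p-morphism*, that is, a continuous map such that 1. $f$ is order preserving; 2. if $f(x)\preccurlyeq' y'$, then there is $y$ with $x\preccurlyeq y$ and $f(y)=y'$; 3. if $Rxyz$, then $R'f(x)f(y)f(z)$; 4. if $w'\preccurlyeq' f(x)$ and $R'y'z'w'$, then there are $w,y,z$ with $w\preccurlyeq x$, $Ryzw$, $y'\preccurlyeq' f(y)$, $z'\preccurlyeq' f(z)$; 5. if $f(x)\preccurlyeq' w'$ and $R'w'y'z'$, then there are $w,y,z$ with $x\preccurlyeq w$, $Rwyz$, $y'\preccurlyeq' f(y)$, $f(z)\preccurlyeq' z'$; 6. if $f(x)\preccurlyeq' w'$ and $R'y'w'z'$, then there are $w,y,z$ with $x\preccurlyeq w$, $Rywz$, $y'\preccurlyeq'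 f(y)$, $f(z)\preccurlyeq' z'$. These form the category $\mathrm{IntLaySp}$. Morphisms of Esakia spaces are the continuous maps satisfying 1 and 2. Then $\mathrm{LayHeyAlg}$ and $\mathrm{IntLaySp}$ are dually equivalent: there is an equivalence $\mathrm{LayHeyAlg}^{op}\simeq\mathrm{IntLaySp}$, given by the following two functors. - $G$ sends $X$ to $\mathcal C_\preccurlyeq(X)$ with the order $\subseteq$ and the operations $\blacktriangleright_R$, $-\!\blacktriangleright_R$, $\blacktriangleright\!-_R$, and sends $g$ to $C\mapsto g^{-1}[C]$. - $F$ sends $A$ (up to natural isomorphism) to the set of its prime filters (nonempty, proper), ordered by $\subseteq$, with the topology generated by the sets $\{P\mid a\in P\}$ and $\{P\mid a\notin P\}$ for $a\in A$, and with $R\,P_0P_1P_2$ iff $a\blacktriangleright b\in P_2$ for all $a\in P_0$, $b\in P_1$; it sends $f$ to $P\mapsto f^{-1}[P]$. This extends Esakia duality: omitting the relation $R$ and the operations $\blacktriangleright$, $-\!\blacktriangleright$, $\blacktriangleright\!-$, the analogous functors form an equivalence $\mathrm{HeytAlg}^{op}\simeq\mathrm{EsakiaSp}$ between the opposite of the category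 of Heyting algebras and the category of Esakia spaces, and the functors of the two dualities commute (for $F$, up to natural isomorphism) with the forgetful functors $\mathrm{LayHeyAlg}\to\mathrm{HeytAlg}$ and $\mathrm{IntLaySp}\to\mathrm{EsakiaSp}$. -/

import Mathlib

open CategoryTheory Opposite

universe u

/-! ### Layered Heyting algebras -/

/-- A layered Heyting algebra: a Heyting algebra with a binary operation `lay` and its two
residuals `layR`, `layL`; no further law is imposed on `lay`. -/
class LayeredHeytingAlgebra (A : Type*) extends HeytingAlgebra A where
  /-- the layering operation `a ▸ b` -/
  lay : A → A → A
  /-- the residual `b -▸ c` -/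
  layR : A → A → A
  /-- the residual `a ▸- c` -/
  layL : A → A → A
  lay_le_iff_le_layR (a b c : A) : lay a b ≤ c ↔ a ≤ layR b c
  lay_le_iff_le_layL (a b c : A) : lay a b ≤ c ↔ b ≤ layL a c

open LayeredHeytingAlgebra

/-- Homomorphisms of layered Heyting algebras preserve all the operations. -/
structure LayeredHeytingHom (A B : Type*) [LayeredHeytingAlgebra A] [LayeredHeytingAlgebra B]
    extends HeytingHom A B where
  map_lay' (a b : A) : toFun (lay a b) = lay (toFun a) (toFun b)
  map_layR' (a b : A) : toFun (layR a b) = layR (toFun a) (toFun b)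
  map_layL' (a b : A) : toFun (layL a b) = layL (toFun a) (toFun b)

namespace LayeredHeytingHom

variable {A B C : Type*} [LayeredHeytingAlgebra A] [LayeredHeytingAlgebra B]
  [LayeredHeytingAlgebra C]

instance : FunLike (LayeredHeytingHom A B) A B where
  coe f := f.toHeytingHom
  coe_injective f g h := by
    obtain ⟨f, _, _, _⟩ := f
    obtain ⟨g, _, _, _⟩ := g
    obtain rfl : f = g := DFunLike.coe_injective h
    rfl

/-- The identity homomorphism. -/
protected def id (A : Type*) [LayeredHeytingAlgebra A] : LayeredHeytingHom A A where
  toHeytingHom := HeytingHom.id A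
  map_lay' _ _ := rfl
  map_layR' _ _ := rfl
  map_layL' _ _ := rfl

/-- Composition of homomorphisms. -/
def comp (g : LayeredHeytingHom B C) (f : LayeredHeytingHom A B) : LayeredHeytingHom A C where
  toHeytingHom := g.toHeytingHom.comp f.toHeytingHom
  map_lay' a b := (congrArg g.toFun (f.map_lay' a b)).trans (g.map_lay' _ _)
  map_layR' a b := (congrArg g.toFun (f.map_layR' a b)).trans (g.map_layR' _ _)
  map_layL' a b := (congrArg g.toFun (f.map_layL' a b)).trans (g.map_layL' _ _)

end LayeredHeytingHom

/-- The objects of the category of layered Heyting algebras. -/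
structure LayHeyAlg where
  carrier : Type u
  [str : LayeredHeytingAlgebra carrier]

namespace LayHeyAlg

attribute [instance] LayHeyAlg.str

instance : CoeSort LayHeyAlg.{u} (Type u) := ⟨LayHeyAlg.carrier⟩

/-- The category of layered Heyting algebras and their homomorphisms. -/
instance : Category LayHeyAlg.{u} where
  Hom A B := LayeredHeytingHom A B
  id A := LayeredHeytingHom.id A
  comp f g := LayeredHeytingHom.comp g f

instance : ConcreteCategory LayHeyAlg.{u} (fun A B => LayeredHeytingHom A B) where
  hom f := f
  ofHom f := f

/-- The functor forgetting the layering operations. -/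
def toHeytAlg : LayHeyAlg.{u} ⥤ HeytAlg.{u} where
  obj A := HeytAlg.of A
  map f := HeytAlg.ofHom (ConcreteCategory.hom f).toHeytingHom

end LayHeyAlg

/-! ### Esakia spaces -/

/-- Esakia spaces: Priestley spaces in which the downward closure of a clopen set is clopen. -/
class EsakiaSpace (X : Type*) [TopologicalSpace X] [PartialOrder X] : Prop
    extends CompactSpace X, PriestleySpace X where
  isClopen_lowerClosure {C : Set X} : IsClopen C → IsClopen {x : X | ∃ y ∈ C, x ≤ y}

/-- The objects of the category of Esakia spaces. -/
structure EsakiaSp where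
  carrier : Type u
  [top : TopologicalSpace carrier]
  [order : PartialOrder carrier]
  [esakia : EsakiaSpace carrier]

namespace EsakiaSp

attribute [instance] EsakiaSp.top EsakiaSp.order EsakiaSp.esakia

instance : CoeSort EsakiaSp.{u} (Type u) := ⟨EsakiaSp.carrier⟩

/-- The category of Esakia spaces, with continuous p-morphisms as morphisms. -/
instance : Category EsakiaSp.{u} where
  Hom X Y := EsakiaHom X Y
  id X := EsakiaHom.id X
  comp f g := EsakiaHom.comp g f

instance : ConcreteCategory EsakiaSp.{u} (fun X Y => EsakiaHom X Y) where
  hom f := f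
  ofHom f := f

end EsakiaSp

/-! ### Frames with a ternary relation, their complex operations and p-morphisms -/

section Frame

variable {X : Type*} [Preorder X]

/-- `A ▸_R B` -/
def frameLay (R : X → X → X → Prop) (A B : Set X) : Set X :=
  {x | ∃ w y z, w ≤ x ∧ R y z w ∧ y ∈ A ∧ z ∈ B}

/-- `A -▸_R B` -/
def frameLayR (R : X → X → X → Prop) (A B : Set X) : Set X :=
  {x | ∀ w y z, x ≤ w → R w y z → y ∈ A → z ∈ B}

/-- `A ▸-_R B` -/
def frameLayL (R : X → X → X → Prop) (A B : Set X) : Set X :=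
  {x | ∀ w y z, x ≤ w → R y w z → y ∈ A → z ∈ B}

/-- `A ⇒ B` -/
def frameImp (A B : Set X) : Set X :=
  {x | ∀ x', x ≤ x' → x' ∈ A → x' ∈ B}

end Frame

/-- Intuitionistic layered p-morphisms between preorders with a ternary relation. -/
structure IsLayeredPMorphism {X X' : Type*} [Preorder X] [Preorder X']
    (R : X → X → X → Prop) (R' : X' → X' → X' → Prop) (f : X → X') : Prop where
  monotone : Monotone f
  lift_le (x : X) (y' : X') : f x ≤ y' → ∃ y, x ≤ y ∧ f y = y'
  map_rel (x y z : X) : R x y z → R' (f x) (f y) (f z)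
  lift_lay (x : X) (w' y' z' : X') : w' ≤ f x → R' y' z' w' →
    ∃ w y z, w ≤ x ∧ R y z w ∧ y' ≤ f y ∧ z' ≤ f z
  lift_layR (x : X) (w' y' z' : X') : f x ≤ w' → R' w' y' z' →
    ∃ w y z, x ≤ w ∧ R w y z ∧ y' ≤ f y ∧ f z ≤ z'
  lift_layL (x : X) (w' y' z' : X') : f x ≤ w' → R' y' w' z' →
    ∃ w y z, x ≤ w ∧ R y w z ∧ y' ≤ f y ∧ f z ≤ z'

theorem IsLayeredPMorphism.id {X : Type*} [Preorder X] (R : X → X → X → Prop) :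
    IsLayeredPMorphism R R (fun x : X => x) where
  monotone := monotone_id
  lift_le _ y' h := ⟨y', h, rfl⟩
  map_rel _ _ _ h := h
  lift_lay _ w' y' z' h hR := ⟨w', y', z', h, hR, le_rfl, le_rfl⟩
  lift_layR _ w' y' z' h hR := ⟨w', y', z', h, hR, le_rfl, le_rfl⟩
  lift_layL _ w' y' z' h hR := ⟨w', y', z', h, hR, le_rfl, le_rfl⟩

theorem IsLayeredPMorphism.comp {X Y Z : Type*} [Preorder X] [Preorder Y] [Preorder Z]
    {R : X → X → X → Prop} {S : Y → Y → Y → Prop} {T : Z → Z → Z → Prop} {g : Y → Z} {f : X → Y}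
    (hg : IsLayeredPMorphism S T g) (hf : IsLayeredPMorphism R S f) :
    IsLayeredPMorphism R T (fun x => g (f x)) where
  monotone := hg.monotone.comp hf.monotone
  lift_le x z h := by
    obtain ⟨y, hy, rfl⟩ := hg.lift_le _ _ h
    obtain ⟨x', hx, rfl⟩ := hf.lift_le _ _ hy
    exact ⟨x', hx, rfl⟩
  map_rel x y z h := hg.map_rel _ _ _ (hf.map_rel _ _ _ h)
  lift_lay x w'' y'' z'' h hR := by
    obtain ⟨w', y', z', hw', hR', hy', hz'⟩ := hg.lift_lay _ _ _ _ h hR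
    obtain ⟨w, y, z, hw, hR, hy, hz⟩ := hf.lift_lay _ _ _ _ hw' hR'
    exact ⟨w, y, z, hw, hR, hy'.trans (hg.monotone hy), hz'.trans (hg.monotone hz)⟩
  lift_layR x w'' y'' z'' h hR := by
    obtain ⟨w', y', z', hw', hR', hy', hz'⟩ := hg.lift_layR _ _ _ _ h hR
    obtain ⟨w, y, z, hw, hR, hy, hz⟩ := hf.lift_layR _ _ _ _ hw' hR'
    exact ⟨w, y, z, hw, hR, hy'.trans (hg.monotone hy), (hg.monotone hz).trans hz'⟩
  lift_layL x w'' y'' z'' h hR := by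
    obtain ⟨w', y', z', hw', hR', hy', hz'⟩ := hg.lift_layL _ _ _ _ h hR
    obtain ⟨w, y, z, hw, hR, hy, hz⟩ := hf.lift_layL _ _ _ _ hw' hR'
    exact ⟨w, y, z, hw, hR, hy'.trans (hg.monotone hy), (hg.monotone hz).trans hz'⟩

/-! ### Intuitionistic layered spaces -/

/-- The objects of the category of intuitionistic layered spaces: Esakia spaces with a ternary
relation `R` such that the clopen upper sets are closed under the three operations given by `R`,
and such that every triple outside `R` is separated from `R` by clopen upper sets. -/
structure IntLaySp where
  carrier : Type u
  [top : TopologicalSpace carrier]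
  [order : PartialOrder carrier]
  [esakia : EsakiaSpace carrier]
  R : carrier → carrier → carrier → Prop
  isClopenUpper_lay (C D : ClopenUpperSet carrier) :
    IsClopen (frameLay R (C : Set carrier) D) ∧ IsUpperSet (frameLay R (C : Set carrier) D)
  isClopenUpper_layR (C D : ClopenUpperSet carrier) :
    IsClopen (frameLayR R (C : Set carrier) D) ∧ IsUpperSet (frameLayR R (C : Set carrier) D)
  isClopenUpper_layL (C D : ClopenUpperSet carrier) :
    IsClopen (frameLayL R (C : Set carrier) D) ∧ IsUpperSet (frameLayL R (C : Set carrier) D)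
  exists_separation (x y z : carrier) : ¬ R x y z →
    ∃ C D : ClopenUpperSet carrier, x ∈ C ∧ y ∈ D ∧ z ∉ frameLay R (C : Set carrier) D

namespace IntLaySp

attribute [instance] IntLaySp.top IntLaySp.order IntLaySp.esakia

instance : CoeSort IntLaySp.{u} (Type u) := ⟨IntLaySp.carrier⟩

/-- Morphisms of intuitionistic layered spaces: continuous intuitionistic layered p-morphisms. -/
structure Hom (X Y : IntLaySp.{u}) where
  toFun : X → Y
  continuous_toFun : Continuous toFun
  isLayeredPMorphism : IsLayeredPMorphism X.R Y.R toFun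

instance (X Y : IntLaySp.{u}) : FunLike (Hom X Y) X Y where
  coe f := f.toFun
  coe_injective f g h := by
    cases f
    cases g
    congr

/-- The category of intuitionistic layered spaces. -/
instance : Category IntLaySp.{u} where
  Hom X Y := Hom X Y
  id X := ⟨fun x => x, continuous_id, .id X.R⟩
  comp f g := ⟨fun x => g.toFun (f.toFun x), g.continuous_toFun.comp f.continuous_toFun,
    g.isLayeredPMorphism.comp f.isLayeredPMorphism⟩

instance : ConcreteCategory IntLaySp.{u} (fun X Y => Hom X Y) where
  hom f := f
  ofHom f := f

/-- A continuous layered p-morphism is in particular a morphism of Esakia spaces. -/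
def Hom.toEsakiaHom {X Y : IntLaySp.{u}} (f : Hom X Y) : EsakiaHom X Y where
  toFun := f.toFun
  monotone' := f.isLayeredPMorphism.monotone
  continuous_toFun := f.continuous_toFun
  exists_map_eq_of_map_le' _ _ h := f.isLayeredPMorphism.lift_le _ _ h

/-- The functor forgetting the ternary relation. -/
def toEsakiaSp : IntLaySp.{u} ⥤ EsakiaSp.{u} where
  obj X := ⟨X⟩
  map f := (ConcreteCategory.hom f).toEsakiaHom

end IntLaySp

/-! ### The algebra of clopen upper sets -/

section ClopenUpper

variable {X Y : Type*} [TopologicalSpace X] [PartialOrder X] [TopologicalSpace Y] [PartialOrder Y]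

/-- Implication of clopen upper sets of an Esakia space. -/
def clopenUpperImp [EsakiaSpace X] (C D : ClopenUpperSet X) : ClopenUpperSet X where
  carrier := frameImp (C : Set X) D
  isClopen' := by
    have h := (EsakiaSpace.isClopen_lowerClosure (C.isClopen.diff D.isClopen)).compl
    convert h using 1
    ext x
    simp only [frameImp, Set.mem_ofPred_eq, Set.mem_compl_iff, Set.mem_sdiff, not_exists, not_and]
    exact ⟨fun h y hy hxy => hy.2 (h y hxy hy.1), fun h y hxy hy => by
      by_contra hD
      exact h y ⟨hy, hD⟩ hxy⟩
  upper' := fun _ _ hab h x' hx' => h x' (hab.trans hx')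

/-- The Heyting algebra of clopen upper sets of an Esakia space, ordered by inclusion (with union,
intersection and the implication above). -/
instance [EsakiaSpace X] : HeytingAlgebra (ClopenUpperSet X) where
  toLattice := inferInstance
  le_top _ := le_top
  bot_le _ := bot_le
  himp := clopenUpperImp
  le_himp_iff A _ _ :=
    ⟨fun h _ hx => h hx.1 _ le_rfl hx.2, fun h _ hx _ hle hB => h ⟨A.upper hle hx, hB⟩⟩
  compl A := clopenUpperImp A ⊥
  himp_bot _ := rfl

/-- The preimage of a clopen upper set under a continuous monotone map. -/
def ClopenUpperSet.preimage (f : X → Y) (hf : Continuous f) (hm : Monotone f)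
    (C : ClopenUpperSet Y) : ClopenUpperSet X where
  carrier := f ⁻¹' C
  isClopen' := C.isClopen.preimage hf
  upper' := C.upper.preimage hm

/-- The inverse image homomorphism given by a morphism of Esakia spaces. -/
def EsakiaHom.preimageHom [EsakiaSpace X] [EsakiaSpace Y] (f : EsakiaHom X Y) :
    HeytingHom (ClopenUpperSet Y) (ClopenUpperSet X) where
  toFun C := C.preimage f f.continuous_toFun f.monotone'
  map_sup' _ _ := rfl
  map_inf' _ _ := rfl
  map_bot' := rfl
  map_himp' C D := by
    apply SetLike.coe_injective
    ext x
    refine ⟨fun h x' hx hC => h (f x') (f.monotone' hx) hC, fun h y hy hC => ?_⟩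
    obtain ⟨x', hx', rfl⟩ := f.exists_map_eq_of_map_le' hy
    exact h x' hx' hC

end ClopenUpper

/-- The functor of Esakia duality sending an Esakia space to its Heyting algebra of clopen upper
sets, and a morphism to the inverse image map. -/
def EsakiaSp.clopenUpper : EsakiaSp.{u}ᵒᵖ ⥤ HeytAlg.{u} where
  obj X := HeytAlg.of (ClopenUpperSet X.unop)
  map f := HeytAlg.ofHom (ConcreteCategory.hom f.unop).preimageHom

namespace IntLaySp

/-- The layered Heyting algebra of clopen upper sets of an intuitionistic layered space. -/
instance (X : IntLaySp.{u}) : LayeredHeytingAlgebra (ClopenUpperSet X) where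
  toHeytingAlgebra := inferInstance
  lay C D := ⟨⟨frameLay X.R (C : Set X) D, (X.isClopenUpper_lay C D).1⟩, (X.isClopenUpper_lay C D).2⟩
  layR C D :=
    ⟨⟨frameLayR X.R (C : Set X) D, (X.isClopenUpper_layR C D).1⟩, (X.isClopenUpper_layR C D).2⟩
  layL C D :=
    ⟨⟨frameLayL X.R (C : Set X) D, (X.isClopenUpper_layL C D).1⟩, (X.isClopenUpper_layL C D).2⟩
  lay_le_iff_le_layR A _ C :=
    ⟨fun h _ hx w _ _ hxw hR hy => h ⟨_, w, _, le_rfl, hR, A.upper hxw hx, hy⟩,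
      fun h _ ⟨_, _, _, hwx, hR, hy, hz⟩ => C.upper hwx (h hy _ _ _ le_rfl hR hz)⟩
  lay_le_iff_le_layL _ B C :=
    ⟨fun h _ hx w _ _ hxw hR hy => h ⟨_, _, w, le_rfl, hR, hy, B.upper hxw hx⟩,
      fun h _ ⟨_, _, _, hwx, hR, hy, hz⟩ => C.upper hwx (h hz _ _ _ le_rfl hR hy)⟩

/-- The inverse image homomorphism given by a morphism of intuitionistic layered spaces. -/
def Hom.preimageHom {X Y : IntLaySp.{u}} (f : Hom X Y) :
    LayeredHeytingHom (ClopenUpperSet Y) (ClopenUpperSet X) where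
  toHeytingHom := f.toEsakiaHom.preimageHom
  map_lay' C D := by
    apply SetLike.coe_injective
    ext x
    constructor
    · rintro ⟨w', y', z', hw', hR', hy', hz'⟩
      obtain ⟨w, y, z, hw, hR, hy, hz⟩ := f.isLayeredPMorphism.lift_lay _ _ _ _ hw' hR'
      exact ⟨w, y, z, hw, hR, C.upper hy hy', D.upper hz hz'⟩
    · rintro ⟨w, y, z, hw, hR, hy, hz⟩
      exact ⟨f.toFun w, f.toFun y, f.toFun z, f.isLayeredPMorphism.monotone hw,
        f.isLayeredPMorphism.map_rel _ _ _ hR, hy, hz⟩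
  map_layR' C D := by
    apply SetLike.coe_injective
    ext x
    constructor
    · intro h w y z hw hR hy
      exact h _ _ _ (f.isLayeredPMorphism.monotone hw) (f.isLayeredPMorphism.map_rel _ _ _ hR) hy
    · intro h w' y' z' hw' hR' hy'
      obtain ⟨w, y, z, hw, hR, hy, hz⟩ := f.isLayeredPMorphism.lift_layR _ _ _ _ hw' hR'
      exact D.upper hz (h w y z hw hR (C.upper hy hy'))
  map_layL' C D := by
    apply SetLike.coe_injective
    ext x
    constructor
    · intro h w y z hw hR hy
      exact h _ _ _ (f.isLayeredPMorphism.monotone hw) (f.isLayeredPMorphism.map_rel _ _ _ hR) hy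
    · intro h w' y' z' hw' hR' hy'
      obtain ⟨w, y, z, hw, hR, hy, hz⟩ := f.isLayeredPMorphism.lift_layL _ _ _ _ hw' hR'
      exact D.upper hz (h w y z hw hR (C.upper hy hy'))

/-- The functor sending an intuitionistic layered space to its layered Heyting algebra of clopen
upper sets, and a morphism to the inverse image map. -/
def clopenUpper : IntLaySp.{u}ᵒᵖ ⥤ LayHeyAlg.{u} where
  obj X := ⟨ClopenUpperSet X.unop⟩
  map f := (ConcreteCategory.hom f.unop).preimageHom

end IntLaySp

/-! ### Prime filters -/

/-- The prime filters of a Heyting algebra (filters are nonempty, prime filters are proper). -/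
def PrimeFilter (A : Type*) [HeytingAlgebra A] : Type _ :=
  {F : Order.PFilter A // F.IsPrime}

namespace PrimeFilter

variable {A : Type*} [HeytingAlgebra A]

instance : SetLike (PrimeFilter A) A where
  coe F := (F.1 : Set A)
  coe_injective _ _ h := Subtype.ext (SetLike.coe_injective h)

/-- Prime filters are ordered by inclusion. -/
instance : PartialOrder (PrimeFilter A) := .ofSetLike (PrimeFilter A) A

/-- The topology generated by the sets `{F | a ∈ F}` and their complements. -/
instance : TopologicalSpace (PrimeFilter A) :=
  .generateFrom ((Set.range fun a : A => {F : PrimeFilter A | a ∈ F}) ∪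
    Set.range fun a : A => {F : PrimeFilter A | a ∉ F})

end PrimeFilter

/-- The ternary relation on the prime filters of a layered Heyting algebra. -/
def primeFilterRel {A : Type*} [LayeredHeytingAlgebra A] (F₀ F₁ F₂ : PrimeFilter A) : Prop :=
  ∀ a ∈ F₀, ∀ b ∈ F₁, lay a b ∈ F₂

/-- A presentation of a functor as the prime filter functor of Esakia duality: up to a natural
homeomorphism and order isomorphism, `A` is sent to its ordered space of prime filters, and a
homomorphism to the inverse image map on prime filters. -/
structure PrimeFilterPresentation (F : HeytAlg.{u}ᵒᵖ ⥤ EsakiaSp.{u}) where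
  equiv (A : HeytAlg.{u}) : F.obj (op A) ≃ₜ PrimeFilter A
  equiv_le_iff (A : HeytAlg.{u}) (x y : F.obj (op A)) : equiv A x ≤ equiv A y ↔ x ≤ y
  mem_equiv_map (A B : HeytAlg.{u}) (f : A ⟶ B) (x : F.obj (op B)) (a : A) :
    a ∈ equiv A (F.map f.op x) ↔ f a ∈ equiv B x

/-- A presentation of a functor as the prime filter functor on layered Heyting algebras: up to a
natural homeomorphism, order isomorphism and isomorphism of ternary relations, `A` is sent to its
space of prime filters, and a homomorphism to the inverse image map on prime filters. -/
structure LayeredPrimeFilterPresentation (F : LayHeyAlg.{u}ᵒᵖ ⥤ IntLaySp.{u}) where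
  equiv (A : LayHeyAlg.{u}) : F.obj (op A) ≃ₜ PrimeFilter A
  equiv_le_iff (A : LayHeyAlg.{u}) (x y : F.obj (op A)) : equiv A x ≤ equiv A y ↔ x ≤ y
  rel_equiv_iff (A : LayHeyAlg.{u}) (x y z : F.obj (op A)) :
    primeFilterRel (equiv A x) (equiv A y) (equiv A z) ↔ (F.obj (op A)).R x y z
  mem_equiv_map (A B : LayHeyAlg.{u}) (f : A ⟶ B) (x : F.obj (op B)) (a : A) :
    a ∈ equiv A (F.map f.op x) ↔ f a ∈ equiv B x

/-!
Both dualities send an algebra `A` to the space of its prime filters and a space to the algebra of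
its clopen upper sets, and both rest on the prime filter theorem
`PrimeFilter.exists_subset_disjoint`.

For Esakia duality, the space of prime filters is compact because an ultrafilter on it converges to
the prime filter of those `a` for which `{x | a ∈ x}` belongs to the ultrafilter. By the prime
filter theorem the downward closure of the basic clopen set `{x | c ∈ x ∧ d ∉ x}` is the complement of
`{x | c ⇨ d ∈ x}`; hence the downward closure of any clopen set is the complement of some
`{x | a ∈ x}` (`PrimeFilter.exists_lowerClosure_eq`). This gives the Esakia axiom and, applied to
the complement of a clopen upper set, the surjectivity of `a ↦ {x | a ∈ x}` onto the clopen upper sets,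
so that `A` is the algebra of clopen upper sets of its prime filter space. Conversely a point of an
Esakia space is determined by the clopen upper sets containing it, and by compactness every prime
filter of clopen upper sets arises from a point (`EsakiaSpace.primeFilterHomeomorph`).

For the layered structure there is one further ingredient, `PrimeFilter.exists_primeFilterRel`: two
filters whose `▸`-products avoid an ideal extend to prime filters that are related to a third prime
filter avoiding that ideal. It shows that `a ↦ {x | a ∈ x}` carries `▸` and its residuals to the
operations given by the ternary relation, and that inverse images under homomorphisms satisfy the
three lifting conditions of a layered p-morphism. On the side of spaces, the separation axiom says
that the homeomorphism of Esakia duality preserves and reflects the ternary relation.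
-/

open Set

namespace PrimeFilter

/-! ### Prime filters and the prime filter theorem -/

section Basic

variable {A : Type*} [HeytingAlgebra A] (x : PrimeFilter A) {a b : A}

theorem mem_of_le (h : a ≤ b) (ha : a ∈ x) : b ∈ x :=
  Order.PFilter.mem_of_le (F := x.1) h ha

theorem top_mem : ⊤ ∈ x :=
  Order.PFilter.top_mem (F := x.1)

theorem inf_mem (ha : a ∈ x) (hb : b ∈ x) : a ⊓ b ∈ x :=
  Order.PFilter.inf_mem (F := x.1) ha hb

theorem bot_notMem : ⊥ ∉ x := by
  obtain ⟨a, ha⟩ := x.2.compl_ideal.Nonempty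
  exact x.2.compl_ideal.IsLowerSet bot_le ha

theorem sup_notMem (ha : a ∉ x) (hb : b ∉ x) : a ⊔ b ∉ x := by
  obtain ⟨c, hc, hac, hbc⟩ := x.2.compl_ideal.Directed a ha b hb
  exact fun h => hc (x.mem_of_le (sup_le hac hbc) h)

theorem sup_mem_iff : a ⊔ b ∈ x ↔ a ∈ x ∨ b ∈ x := by
  refine ⟨fun h => ?_, ?_⟩
  · by_contra! h'
    exact x.sup_notMem h'.1 h'.2 h
  · rintro (h | h)
    exacts [x.mem_of_le le_sup_left h, x.mem_of_le le_sup_right h]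

theorem inf_mem_iff : a ⊓ b ∈ x ↔ a ∈ x ∧ b ∈ x :=
  ⟨fun h => ⟨x.mem_of_le inf_le_left h, x.mem_of_le inf_le_right h⟩, fun h => x.inf_mem h.1 h.2⟩

theorem infClosed_coe : InfClosed (x : Set A) := fun _ ha _ hb => x.inf_mem ha hb

theorem supClosed_compl : SupClosed (x : Set A)ᶜ := fun _ ha _ hb => x.sup_notMem ha hb

theorem coe_nonempty : (x : Set A).Nonempty := ⟨⊤, x.top_mem⟩

theorem compl_nonempty : (x : Set A)ᶜ.Nonempty := ⟨⊥, x.bot_notMem⟩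

/-- A prime filter from the elementary closure properties of its underlying set. -/
def ofSet (S : Set A) (upper : IsUpperSet S) (top : ⊤ ∈ S) (inf : InfClosed S) (bot : ⊥ ∉ S)
    (sup : SupClosed Sᶜ) : PrimeFilter A :=
  ⟨(Order.IsPFilter.of_def ⟨⊤, top⟩ (fun _ ha _ hb => ⟨_, inf ha hb, inf_le_left, inf_le_right⟩)
      (fun h ha => upper h ha)).toPFilter,
    ⟨⟨upper.compl, ⟨⊥, bot⟩, fun _ ha _ hb => ⟨_, sup ha hb, le_sup_left, le_sup_right⟩⟩⟩⟩

/-- The prime filter theorem, for bases of a filter and of an ideal: if no element of the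
`⊓`-closed set `S` lies below an element of the `⊔`-closed set `T`, then a prime filter contains
`S` and avoids `T`. -/
theorem exists_subset_disjoint {S T : Set A} (hS : S.Nonempty) (hSinf : InfClosed S)
    (hT : T.Nonempty) (hTsup : SupClosed T) (h : ∀ s ∈ S, ∀ t ∈ T, ¬ s ≤ t) :
    ∃ x : PrimeFilter A, S ⊆ x ∧ ∀ t ∈ T, t ∉ x := by
  have hF : Order.IsPFilter {a | ∃ s ∈ S, s ≤ a} := by
    refine .of_def (hS.mono fun s hs => ⟨s, hs, le_rfl⟩) ?_ ?_
    · rintro a ⟨s, hs, hsa⟩ b ⟨t, ht, htb⟩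
      exact ⟨s ⊓ t, ⟨_, hSinf hs ht, le_rfl⟩, inf_le_left.trans hsa, inf_le_right.trans htb⟩
    · rintro a b hab ⟨s, hs, hsa⟩
      exact ⟨s, hs, hsa.trans hab⟩
  have hI : Order.IsIdeal {a | ∃ t ∈ T, a ≤ t} := by
    refine ⟨?_, hT.mono fun t ht => ⟨t, ht, le_rfl⟩, ?_⟩
    · rintro a b hba ⟨t, ht, hat⟩
      exact ⟨t, ht, hba.trans hat⟩
    · rintro a ⟨s, hs, has⟩ b ⟨t, ht, hbt⟩
      exact ⟨s ⊔ t, ⟨_, hTsup hs ht, le_rfl⟩, has.trans le_sup_left, hbt.trans le_sup_right⟩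
  obtain ⟨J, hJ, hIJ, hFJ⟩ := DistribLattice.prime_ideal_of_disjoint_filter_ideal
    (F := hF.toPFilter) (I := hI.toIdeal) (by
      refine Set.disjoint_left.2 ?_
      rintro a ⟨s, hs, hsa⟩ ⟨t, ht, hat⟩
      exact h s hs t ht (hsa.trans hat))
  refine ⟨⟨hJ.toPrimePair.F, hJ.toPrimePair.F_isPrime⟩, fun s hs hsJ => ?_, fun t ht htJ => ?_⟩
  · exact Set.disjoint_left.1 hFJ ⟨s, hs, le_rfl⟩ hsJ
  · exact htJ (hIJ ⟨t, ht, le_rfl⟩)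

theorem exists_mem_notMem_of_not_le (h : ¬ a ≤ b) : ∃ x : PrimeFilter A, a ∈ x ∧ b ∉ x := by
  obtain ⟨x, hx, hx'⟩ := exists_subset_disjoint (singleton_nonempty a) infClosed_singleton
    (singleton_nonempty b) supClosed_singleton (by simpa using h)
  exact ⟨x, hx rfl, hx' b rfl⟩

/-- Membership of `a ⇨ b` is the Kripke clause for implication over the order of the prime filters.
If `a ⇨ b ∉ x`, then the filter generated by `x` and `a`, which is `{c | a ⇨ c ∈ x}`, does not
contain `b`. -/
theorem himp_mem_iff : a ⇨ b ∈ x ↔ ∀ y, x ≤ y → a ∈ y → b ∈ y := by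
  refine ⟨fun h y hxy ha => y.mem_of_le himp_inf_le (y.inf_mem (hxy h) ha), fun h => ?_⟩
  by_contra hab
  obtain ⟨y, hy, hy'⟩ := exists_subset_disjoint (S := {c | a ⇨ c ∈ x}) (T := {b})
    ⟨⊤, by simpa using x.top_mem⟩
    (fun c hc d hd => by
      change a ⇨ (c ⊓ d) ∈ x
      rw [himp_inf_distrib]
      exact x.inf_mem hc hd)
    (singleton_nonempty b) supClosed_singleton
    (by
      rintro c hc _ rfl hcb
      exact hab (x.mem_of_le (himp_le_himp_left hcb) hc))
  refine hy' b rfl (h y (fun c hc => hy ?_) (hy ?_))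
  · exact x.mem_of_le le_himp hc
  · simpa using x.top_mem

end Basic

/-! ### The Esakia space of prime filters -/

section Topology

variable {A : Type*} [HeytingAlgebra A]

theorem isOpen_setOf_mem (a : A) : IsOpen {x : PrimeFilter A | a ∈ x} :=
  .basic _ (.inl ⟨a, rfl⟩)

theorem isOpen_setOf_notMem (a : A) : IsOpen {x : PrimeFilter A | a ∉ x} :=
  .basic _ (.inr ⟨a, rfl⟩)

theorem isClopen_setOf_mem (a : A) : IsClopen {x : PrimeFilter A | a ∈ x} :=
  ⟨⟨isOpen_setOf_notMem a⟩, isOpen_setOf_mem a⟩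

theorem continuous_iff {X : Type*} [TopologicalSpace X] {f : X → PrimeFilter A} :
    Continuous f ↔ ∀ a, IsClopen {x | a ∈ f x} := by
  refine ⟨fun h a => (isClopen_setOf_mem a).preimage h, fun h => continuous_generateFrom_iff.2 ?_⟩
  rintro _ (⟨a, rfl⟩ | ⟨a, rfl⟩)
  exacts [(h a).isOpen, (h a).compl.isOpen]

/-- The sets `{y | c ∈ y ∧ d ∉ y}` form a basis of the topology. -/
theorem exists_mem_notMem_subset {U : Set (PrimeFilter A)} (hU : IsOpen U) {x : PrimeFilter A}
    (hx : x ∈ U) : ∃ c ∈ x, ∃ d ∉ x, {y : PrimeFilter A | c ∈ y ∧ d ∉ y} ⊆ U := by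
  induction hU with
  | basic s hs =>
    obtain ⟨a, rfl⟩ | ⟨a, rfl⟩ := hs
    · exact ⟨a, hx, ⊥, x.bot_notMem, fun y hy => hy.1⟩
    · exact ⟨⊤, x.top_mem, a, hx, fun y hy => hy.2⟩
  | univ => exact ⟨⊤, x.top_mem, ⊥, x.bot_notMem, subset_univ _⟩
  | inter s t _ _ hs ht =>
    obtain ⟨c, hc, d, hd, h⟩ := hs hx.1
    obtain ⟨c', hc', d', hd', h'⟩ := ht hx.2
    refine ⟨c ⊓ c', x.inf_mem hc hc', d ⊔ d', x.sup_notMem hd hd', fun y hy => ?_⟩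
    rw [mem_ofPred_eq, inf_mem_iff, sup_mem_iff, not_or] at hy
    exact ⟨h ⟨hy.1.1, hy.2.1⟩, h' ⟨hy.1.2, hy.2.2⟩⟩
  | sUnion S _ ih =>
    obtain ⟨s, hs, hxs⟩ := hx
    obtain ⟨c, hc, d, hd, h⟩ := ih s hs hxs
    exact ⟨c, hc, d, hd, h.trans (subset_sUnion_of_mem hs)⟩

/-- An ultrafilter `𝒰` on the space of prime filters converges to `{a | {x | a ∈ x} ∈ 𝒰}`, which
is itself a prime filter. -/
instance : CompactSpace (PrimeFilter A) := by
  refine ⟨isCompact_iff_ultrafilter_le_nhds.2 fun 𝒰 _ => ?_⟩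
  refine ⟨ofSet {a | {x : PrimeFilter A | a ∈ x} ∈ 𝒰} ?_ ?_ ?_ ?_ ?_, mem_univ _, ?_⟩
  · exact fun a b hab ha => Filter.mem_of_superset ha fun x hx => x.mem_of_le hab hx
  · exact Filter.mem_of_superset Filter.univ_mem fun x _ => x.top_mem
  · exact fun a ha b hb => Filter.mem_of_superset (Filter.inter_mem ha hb)
      fun x hx => x.inf_mem hx.1 hx.2
  · exact fun h => 𝒰.empty_notMem (Filter.mem_of_superset h fun x hx => x.bot_notMem hx)
  · intro a ha b hb h
    rw [mem_compl_iff, mem_ofPred_eq, ← Ultrafilter.compl_mem_iff_notMem] at ha hb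
    refine 𝒰.empty_notMem (Filter.mem_of_superset (Filter.inter_mem (Filter.inter_mem ha hb) h) ?_)
    exact fun x hx => x.sup_notMem hx.1.1 hx.1.2 hx.2
  · rw [TopologicalSpace.nhds_generateFrom]
    refine le_iInf₂ fun s hs => Filter.le_principal_iff.2 ?_
    obtain ⟨hx, ⟨a, rfl⟩ | ⟨a, rfl⟩⟩ := hs
    · exact hx
    · exact Ultrafilter.compl_mem_iff_notMem.2 hx

/-- Every clopen set has the complement of some `{x | a ∈ x}` as its downward closure: for the basic
clopen set `{x | c ∈ x ∧ d ∉ x}` one takes `a = c ⇨ d`, and a clopen set is a finite union of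
these. -/
theorem exists_lowerClosure_eq {C : Set (PrimeFilter A)} (hC : IsClopen C) :
    ∃ a : A, {x | ∃ y ∈ C, x ≤ y} = {x | a ∉ x} := by
  have key : ∃ a : A, C ⊆ {x | a ∉ x} ∧ {x | a ∉ x} ⊆ {x | ∃ y ∈ C, x ≤ y} := by
    refine hC.isClosed.isCompact.induction_on
      (p := fun s => ∃ a : A, s ⊆ {x | a ∉ x} ∧ {x | a ∉ x} ⊆ {x | ∃ y ∈ C, x ≤ y}) ?_ ?_ ?_ ?_
    · exact ⟨⊤, empty_subset _, fun x hx => (hx x.top_mem).elim⟩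
    · rintro s t hst ⟨a, ha, ha'⟩
      exact ⟨a, hst.trans ha, ha'⟩
    · rintro s t ⟨a, ha, ha'⟩ ⟨b, hb, hb'⟩
      refine ⟨a ⊓ b, ?_, fun x hx => ?_⟩
      · rintro x (hx | hx) hab
        exacts [ha hx (x.inf_mem_iff.1 hab).1, hb hx (x.inf_mem_iff.1 hab).2]
      · rw [mem_ofPred_eq, inf_mem_iff, not_and_or] at hx
        exact hx.elim (fun h => ha' h) (fun h => hb' h)
    · intro x hx
      obtain ⟨c, hc, d, hd, h⟩ := exists_mem_notMem_subset hC.isOpen hx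
      refine ⟨{y | c ∈ y ∧ d ∉ y}, mem_nhdsWithin_of_mem_nhds ?_, c ⇨ d, ?_, ?_⟩
      · exact ((isOpen_setOf_mem c).inter (isOpen_setOf_notMem d)).mem_nhds ⟨hc, hd⟩
      · exact fun y hy hcd => hy.2 (y.himp_mem_iff.1 hcd y le_rfl hy.1)
      · intro y hy
        rw [mem_ofPred_eq, himp_mem_iff] at hy
        push Not at hy
        obtain ⟨z, hyz, hcz, hdz⟩ := hy
        exact ⟨z, h ⟨hcz, hdz⟩, hyz⟩
  obtain ⟨a, ha, ha'⟩ := key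
  refine ⟨a, Subset.antisymm ?_ ha'⟩
  rintro x ⟨y, hy, hxy⟩ hax
  exact ha hy (hxy hax)

instance : EsakiaSpace (PrimeFilter A) where
  priestley {x y} h := by
    obtain ⟨a, hax, hay⟩ := SetLike.not_le_iff_exists.1 h
    exact ⟨{z | a ∈ z}, isClopen_setOf_mem a, fun _ _ hle ha => hle ha, hax, hay⟩
  isClopen_lowerClosure hC := by
    obtain ⟨a, ha⟩ := exists_lowerClosure_eq hC
    rw [ha]
    exact (isClopen_setOf_mem a).compl

variable (A) in
/-- A Heyting algebra is isomorphic to the algebra of clopen upper sets of its space of prime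
filters, by `a ↦ {x | a ∈ x}`. -/
noncomputable def clopenUpperIso : A ≃o ClopenUpperSet (PrimeFilter A) :=
  RelIso.ofSurjective
    (OrderEmbedding.ofMapLEIff
      (fun a => (⟨⟨{x | a ∈ x}, isClopen_setOf_mem a⟩, fun _ _ h ha => h ha⟩ :
        ClopenUpperSet (PrimeFilter A)))
      (fun a b => by
        refine ⟨fun h => ?_, fun h x hx => x.mem_of_le h hx⟩
        by_contra hab
        obtain ⟨x, hax, hbx⟩ := exists_mem_notMem_of_not_le hab
        exact hbx (h hax)))
    (fun C => by
      obtain ⟨a, ha⟩ := exists_lowerClosure_eq C.isClopen.compl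
      refine ⟨a, SetLike.coe_injective ?_⟩
      ext x
      have hx : (∃ y ∈ (C : Set (PrimeFilter A))ᶜ, x ≤ y) ↔ a ∉ x := Set.ext_iff.1 ha x
      change a ∈ x ↔ x ∈ C
      rw [← not_iff_not, ← hx]
      exact ⟨fun ⟨y, hy, hxy⟩ hxC => hy (C.upper hxy hxC), fun h => ⟨x, h, le_rfl⟩⟩)

end Topology

/-! ### Inverse images of prime filters -/

section Comap

variable {A B : Type*} [HeytingAlgebra A] [HeytingAlgebra B]

/-- The inverse image of prime filters under a homomorphism of Heyting algebras. -/
def comap (f : HeytingHom A B) : EsakiaHom (PrimeFilter B) (PrimeFilter A) where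
  toFun x := ofSet (f ⁻¹' x) (fun _ _ h ha => x.mem_of_le (OrderHomClass.mono f h) ha)
    (by rw [mem_preimage, map_top]; exact x.top_mem)
    (x.infClosed_coe.preimage f)
    (by rw [mem_preimage, map_bot]; exact x.bot_notMem)
    (x.supClosed_compl.preimage f)
  monotone' _ _ h _ ha := h ha
  continuous_toFun := continuous_iff.2 fun a => isClopen_setOf_mem (f a)
  exists_map_eq_of_map_le' x y hxy := by
    -- The set of all `c` with `f q ⇨ c ∈ x` for some `q ∈ y` is the filter generated by `x` and
    -- the image of `y`.
    obtain ⟨z, hz, hz'⟩ := exists_subset_disjoint (S := {c | ∃ q ∈ y, f q ⇨ c ∈ x})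
      (T := f '' (y : Set A)ᶜ) ⟨⊤, ⊤, y.top_mem, by simpa using x.top_mem⟩
      (by
        rintro c ⟨q, hq, hc⟩ d ⟨r, hr, hd⟩
        refine ⟨q ⊓ r, y.inf_mem hq hr, ?_⟩
        rw [himp_inf_distrib, map_inf]
        exact x.inf_mem (x.mem_of_le (himp_le_himp_right inf_le_left) hc)
          (x.mem_of_le (himp_le_himp_right inf_le_right) hd))
      (y.compl_nonempty.image f) (y.supClosed_compl.image f)
      (by
        rintro c ⟨q, hq, hc⟩ _ ⟨r, hr, rfl⟩ hcr
        have : f (q ⇨ r) ∈ x := by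
          rw [map_himp]
          exact x.mem_of_le (himp_le_himp_left hcr) hc
        exact hr (y.himp_mem_iff.1 (hxy this) y le_rfl hq))
    refine ⟨z, fun c hc => hz ⟨⊤, y.top_mem, ?_⟩, SetLike.coe_injective ?_⟩
    · simpa using hc
    · refine Subset.antisymm (fun a ha => ?_) fun a ha => hz ⟨a, ha, ?_⟩
      · by_contra hay
        exact hz' _ ⟨a, hay, rfl⟩ ha
      · simpa using x.top_mem

end Comap

end PrimeFilter

/-! ### The points of an Esakia space as prime filters -/

namespace EsakiaSpace

variable {X : Type*} [TopologicalSpace X] [PartialOrder X] [EsakiaSpace X]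

/-- The prime filter `{C | x ∈ C}` of clopen upper sets containing the point `x`. -/
def toPrimeFilter (x : X) : PrimeFilter (ClopenUpperSet X) :=
  .ofSet {C | x ∈ C} (fun _ _ h hx => h hx) trivial (fun _ hC _ hD => ⟨hC, hD⟩) id
    (fun _ hC _ hD h => h.elim hC hD)

theorem toPrimeFilter_le_iff {x y : X} : toPrimeFilter x ≤ toPrimeFilter y ↔ x ≤ y := by
  refine ⟨fun h => ?_, fun h C hC => C.upper h hC⟩
  by_contra hle
  obtain ⟨U, hU, hU', hx, hy⟩ := PriestleySpace.priestley hle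
  exact hy (@h ⟨⟨U, hU⟩, hU'⟩ hx)

theorem toPrimeFilter_injective : Function.Injective (toPrimeFilter (X := X)) := fun _ _ h =>
  le_antisymm (toPrimeFilter_le_iff.1 h.le) (toPrimeFilter_le_iff.1 h.ge)

/-- If the prime filter `p` came from no point, then the complements of its members and its
non-members would cover `X`, and a finite subcover would contradict that `p` is prime. -/
theorem toPrimeFilter_surjective : Function.Surjective (toPrimeFilter (X := X)) := by
  intro p
  by_contra hp
  have hloc (x : X) : (∃ C ∈ p, x ∉ C) ∨ ∃ D ∉ p, x ∈ D := by
    by_contra! hx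
    refine hp ⟨x, SetLike.coe_injective (Set.ext fun C => ⟨fun hC => ?_, fun hC => hx.1 C hC⟩)⟩
    by_contra hCp
    exact hx.2 C hCp hC
  obtain ⟨C, hC, D, hD, h⟩ : ∃ C ∈ p, ∃ D ∉ p, (C : Set X) ∩ univ ⊆ D := by
    refine isCompact_univ.induction_on
      (p := fun s : Set X => ∃ C ∈ p, ∃ D ∉ p, (C : Set X) ∩ s ⊆ D) ?_ ?_ ?_ ?_
    · exact ⟨⊤, p.top_mem, ⊥, p.bot_notMem, by simp⟩
    · rintro s t hst ⟨C, hC, D, hD, h⟩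
      exact ⟨C, hC, D, hD, (inter_subset_inter_right _ hst).trans h⟩
    · rintro s t ⟨C, hC, D, hD, h⟩ ⟨C', hC', D', hD', h'⟩
      refine ⟨C ⊓ C', p.inf_mem hC hC', D ⊔ D', p.sup_notMem hD hD', ?_⟩
      rintro x ⟨hx, hs | ht⟩
      exacts [.inl (h ⟨hx.1, hs⟩), .inr (h' ⟨hx.2, ht⟩)]
    · intro x _
      obtain ⟨C, hC, hxC⟩ | ⟨D, hD, hxD⟩ := hloc x
      · exact ⟨(C : Set X)ᶜ,
          mem_nhdsWithin_of_mem_nhds (C.isClopen.compl.isOpen.mem_nhds hxC),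
          C, hC, ⊥, p.bot_notMem, by simp⟩
      · exact ⟨D, mem_nhdsWithin_of_mem_nhds (D.isClopen.isOpen.mem_nhds hxD),
          ⊤, p.top_mem, D, hD, inter_subset_right⟩
  rw [inter_univ] at h
  exact hD (p.mem_of_le h hC)

variable (X) in
/-- An Esakia space is homeomorphic to the space of prime filters of its algebra of clopen upper
sets: the continuous bijection `toPrimeFilter` goes from a compact space to a Hausdorff space. -/
noncomputable def primeFilterHomeomorph : X ≃ₜ PrimeFilter (ClopenUpperSet X) :=
  Continuous.homeoOfEquivCompactToT2
    (f := Equiv.ofBijective toPrimeFilter ⟨toPrimeFilter_injective, toPrimeFilter_surjective⟩)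
    (PrimeFilter.continuous_iff.2 fun C => C.isClopen)

end EsakiaSpace

/-! ### Esakia duality -/

/-- The functor sending a Heyting algebra to its space of prime filters, and a
homomorphism to the inverse image map. -/
def HeytAlg.primeFilter : HeytAlg.{u}ᵒᵖ ⥤ EsakiaSp.{u} where
  obj A := ⟨PrimeFilter A.unop⟩
  map f := PrimeFilter.comap f.unop.hom

/-- A homeomorphism of Esakia spaces that is also an order isomorphism is an isomorphism. -/
def EsakiaSp.isoMk {X Y : EsakiaSp.{u}} (e : X ≃ₜ Y) (h : ∀ x y, e x ≤ e y ↔ x ≤ y) : X ≅ Y where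
  hom := (⟨⟨⟨e, fun _ _ => (h _ _).2⟩, e.continuous⟩, fun x y hxy =>
    ⟨e.symm y, by rw [← h]; simpa using hxy, e.apply_symm_apply y⟩⟩ : EsakiaHom X Y)
  inv := (⟨⟨⟨e.symm, fun _ _ hxy => by rw [← h]; simpa using hxy⟩, e.symm.continuous⟩,
    fun x y hxy => ⟨e y, by rw [← h] at hxy; simpa using hxy, e.symm_apply_apply y⟩⟩ :
    EsakiaHom Y X)
  hom_inv_id := EsakiaHom.ext e.symm_apply_apply
  inv_hom_id := EsakiaHom.ext e.apply_symm_apply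

/-- Esakia duality. Both natural isomorphisms are given in the direction in which their naturality
squares commute by definition, and then inverted. -/
noncomputable def HeytAlg.esakiaDuality : HeytAlg.{u}ᵒᵖ ≌ EsakiaSp.{u} :=
  .mk HeytAlg.primeFilter EsakiaSp.clopenUpper.rightOp
    (NatIso.ofComponents (F := HeytAlg.primeFilter ⋙ EsakiaSp.clopenUpper.rightOp) (G := 𝟭 _)
      (fun A => (HeytAlg.Iso.mk (PrimeFilter.clopenUpperIso A.unop)).op) (fun _ => rfl)).symm
    (NatIso.ofComponents (F := 𝟭 _) (G := EsakiaSp.clopenUpper.rightOp ⋙ HeytAlg.primeFilter)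
      (fun X => EsakiaSp.isoMk (EsakiaSpace.primeFilterHomeomorph X)
        fun _ _ => EsakiaSpace.toPrimeFilter_le_iff) (fun _ => rfl)).symm

/-! ### Layered Heyting algebras and prime filters -/

namespace LayeredHeytingAlgebra

variable {A : Type*} [LayeredHeytingAlgebra A] {a a' b b' c : A}

theorem gc_lay_layR (b : A) : GaloisConnection (lay · b) (layR b) :=
  fun a c => lay_le_iff_le_layR a b c

theorem gc_lay_layL (a : A) : GaloisConnection (lay a) (layL a) :=
  fun b c => lay_le_iff_le_layL a b c

theorem lay_mono (ha : a ≤ a') (hb : b ≤ b') : lay a b ≤ lay a' b' :=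
  ((gc_lay_layR b).monotone_l ha).trans ((gc_lay_layL a').monotone_l hb)

theorem sup_lay : lay (a ⊔ b) c = lay a c ⊔ lay b c := (gc_lay_layR c).l_sup

theorem lay_sup : lay a (b ⊔ c) = lay a b ⊔ lay a c := (gc_lay_layL a).l_sup

theorem bot_lay : lay ⊥ a = ⊥ := (gc_lay_layR a).l_bot

theorem lay_bot : lay a ⊥ = ⊥ := (gc_lay_layL a).l_bot

theorem layR_lay_le : lay (layR b c) b ≤ c := (gc_lay_layR b).l_u_le c

theorem lay_layL_le : lay a (layL a c) ≤ c := (gc_lay_layL a).l_u_le c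

end LayeredHeytingAlgebra

namespace PrimeFilter

section Rel

variable {A : Type*} [LayeredHeytingAlgebra A] {a b : A}

/-- The prime filter theorem for the ternary relation: if no value of `▸` on `S × T` lies below an
element of `U`, then `S` and `T` extend to prime filters `p` and `q`, and a prime filter `r`
avoids `U`, with `p`, `q`, `r` related. One first finds `r`, then `p`, then `q`; the elements to be
avoided by `p` and `q` form ideals because `▸` preserves finite joins in both arguments. -/
theorem exists_primeFilterRel {S T U : Set A} (hS : S.Nonempty) (hSinf : InfClosed S)
    (hT : T.Nonempty) (hTinf : InfClosed T) (hU : U.Nonempty) (hUsup : SupClosed U)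
    (h : ∀ s ∈ S, ∀ t ∈ T, ∀ u ∈ U, ¬ lay s t ≤ u) :
    ∃ p q r : PrimeFilter A, primeFilterRel p q r ∧ S ⊆ p ∧ T ⊆ q ∧ ∀ u ∈ U, u ∉ r := by
  obtain ⟨s₀, hs₀⟩ := hS
  obtain ⟨t₀, ht₀⟩ := hT
  obtain ⟨r, hr, hrU⟩ := exists_subset_disjoint (S := {c | ∃ s ∈ S, ∃ t ∈ T, lay s t ≤ c})
    ⟨_, s₀, hs₀, t₀, ht₀, le_rfl⟩
    (by
      rintro c ⟨s, hs, t, ht, hc⟩ d ⟨s', hs', t', ht', hd⟩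
      exact ⟨_, hSinf hs hs', _, hTinf ht ht', le_inf
        ((lay_mono inf_le_left inf_le_left).trans hc)
        ((lay_mono inf_le_right inf_le_right).trans hd)⟩)
    hU hUsup
    (by
      rintro c ⟨s, hs, t, ht, hc⟩ u hu hcu
      exact h s hs t ht u hu (hc.trans hcu))
  obtain ⟨p, hSp, hp⟩ := exists_subset_disjoint (T := {a | ∃ t ∈ T, lay a t ∉ r})
    ⟨s₀, hs₀⟩ hSinf ⟨⊥, t₀, ht₀, by rw [bot_lay]; exact r.bot_notMem⟩
    (by
      rintro a ⟨t, ht, ha⟩ b ⟨t', ht', hb⟩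
      refine ⟨_, hTinf ht ht', ?_⟩
      rw [sup_lay]
      exact r.sup_notMem (fun h => ha (r.mem_of_le (lay_mono le_rfl inf_le_left) h))
        (fun h => hb (r.mem_of_le (lay_mono le_rfl inf_le_right) h)))
    (by
      rintro s hs a ⟨t, ht, ha⟩ hsa
      exact ha (hr ⟨s, hs, t, ht, lay_mono hsa le_rfl⟩))
  obtain ⟨q, hTq, hq⟩ := exists_subset_disjoint (T := {b | ∃ a ∈ p, lay a b ∉ r})
    ⟨t₀, ht₀⟩ hTinf ⟨⊥, ⊤, p.top_mem, by rw [lay_bot]; exact r.bot_notMem⟩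
    (by
      rintro b ⟨a, ha, hb⟩ c ⟨a', ha', hc⟩
      refine ⟨_, p.inf_mem ha ha', ?_⟩
      rw [lay_sup]
      exact r.sup_notMem (fun h => hb (r.mem_of_le (lay_mono inf_le_left le_rfl) h))
        (fun h => hc (r.mem_of_le (lay_mono inf_le_right le_rfl) h)))
    (by
      rintro t ht b ⟨a, ha, hb⟩ htb
      exact hp a ⟨t, ht, fun h => hb (r.mem_of_le (lay_mono le_rfl htb) h)⟩ ha)
  refine ⟨p, q, r, fun a ha b hb => ?_, hSp, hTq, hrU⟩
  by_contra hab
  exact hq b ⟨a, ha, hab⟩ hb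

theorem frameLay_setOf_mem :
    frameLay primeFilterRel {x : PrimeFilter A | a ∈ x} {x | b ∈ x} = {x | lay a b ∈ x} := by
  ext x
  refine ⟨fun ⟨w, y, z, hw, hR, ha, hb⟩ => hw (hR a ha b hb), fun h => ?_⟩
  obtain ⟨p, q, r, hR, hp, hq, hr⟩ := exists_primeFilterRel (singleton_nonempty a)
    infClosed_singleton (singleton_nonempty b) infClosed_singleton x.compl_nonempty
    x.supClosed_compl (by
      rintro _ rfl _ rfl u hu hle
      exact hu (x.mem_of_le hle h))
  exact ⟨r, p, q, fun c hc => by_contra fun hcx => hr c hcx hc, hR, hp rfl, hq rfl⟩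

theorem frameLayR_setOf_mem :
    frameLayR primeFilterRel {x : PrimeFilter A | a ∈ x} {x | b ∈ x} = {x | layR a b ∈ x} := by
  ext x
  refine ⟨fun h => ?_, fun h w y z hw hR ha => z.mem_of_le layR_lay_le (hR _ (hw h) _ ha)⟩
  by_contra hx
  obtain ⟨p, q, r, hR, hp, hq, hr⟩ := exists_primeFilterRel x.coe_nonempty x.infClosed_coe
    (singleton_nonempty a) infClosed_singleton (singleton_nonempty b) supClosed_singleton (by
      rintro c hc _ rfl _ rfl hle
      exact hx (x.mem_of_le ((lay_le_iff_le_layR _ _ _).1 hle) hc))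
  exact hr b rfl (h p q r hp hR (hq rfl))

theorem frameLayL_setOf_mem :
    frameLayL primeFilterRel {x : PrimeFilter A | a ∈ x} {x | b ∈ x} = {x | layL a b ∈ x} := by
  ext x
  refine ⟨fun h => ?_, fun h w y z hw hR ha => z.mem_of_le lay_layL_le (hR _ ha _ (hw h))⟩
  by_contra hx
  obtain ⟨p, q, r, hR, hp, hq, hr⟩ := exists_primeFilterRel (singleton_nonempty a)
    infClosed_singleton x.coe_nonempty x.infClosed_coe (singleton_nonempty b) supClosed_singleton
    (by
      rintro _ rfl c hc _ rfl hle
      exact hx (x.mem_of_le ((lay_le_iff_le_layL _ _ _).1 hle) hc))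
  exact hr b rfl (h q p r hq hR (hp rfl))

end Rel

/-- The inverse image map of a homomorphism of layered Heyting algebras is a layered p-morphism. In
each lifting condition the given prime filters of `A` are transported along `f`, and
`exists_primeFilterRel` extends their images to related prime filters of `B`. -/
theorem isLayeredPMorphism_comap {A B : Type*} [LayeredHeytingAlgebra A]
    [LayeredHeytingAlgebra B] (f : LayeredHeytingHom A B) :
    IsLayeredPMorphism primeFilterRel primeFilterRel (comap f.toHeytingHom) where
  monotone := (comap f.toHeytingHom).monotone'
  lift_le _ _ h := (comap f.toHeytingHom).exists_map_eq_of_map_le' h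
  map_rel x y z h a ha b hb := by
    change f.toFun (lay a b) ∈ z
    rw [f.map_lay']
    exact h _ ha _ hb
  lift_lay x w' y' z' hw hR := by
    obtain ⟨p, q, r, h, hp, hq, hr⟩ := exists_primeFilterRel
      (y'.coe_nonempty.image f.toHeytingHom) (y'.infClosed_coe.image f.toHeytingHom)
      (z'.coe_nonempty.image f.toHeytingHom) (z'.infClosed_coe.image f.toHeytingHom)
      x.compl_nonempty x.supClosed_compl (by
        rintro _ ⟨a, ha, rfl⟩ _ ⟨b, hb, rfl⟩ u hu hle
        have : f.toFun (lay a b) ∈ x := hw (hR a ha b hb)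
        rw [f.map_lay'] at this
        exact hu (x.mem_of_le hle this))
    exact ⟨r, p, q, fun c hc => by_contra fun hcx => hr c hcx hc, h,
      fun a ha => hp ⟨a, ha, rfl⟩, fun b hb => hq ⟨b, hb, rfl⟩⟩
  lift_layR x w' y' z' hw hR := by
    obtain ⟨p, q, r, h, hp, hq, hr⟩ := exists_primeFilterRel x.coe_nonempty x.infClosed_coe
      (y'.coe_nonempty.image f.toHeytingHom) (y'.infClosed_coe.image f.toHeytingHom)
      (z'.compl_nonempty.image f.toHeytingHom) (z'.supClosed_compl.image f.toHeytingHom) (by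
        rintro c hc _ ⟨a, ha, rfl⟩ _ ⟨b, hb, rfl⟩ hle
        have : f.toFun (layR a b) ∈ x := by
          rw [f.map_layR']
          exact x.mem_of_le ((lay_le_iff_le_layR _ _ _).1 hle) hc
        exact hb (z'.mem_of_le layR_lay_le (hR _ (hw this) _ ha)))
    exact ⟨p, q, r, hp, h, fun a ha => hq ⟨a, ha, rfl⟩,
      fun b hb => by_contra fun hbz => hr _ ⟨b, hbz, rfl⟩ hb⟩
  lift_layL x w' y' z' hw hR := by
    obtain ⟨p, q, r, h, hp, hq, hr⟩ := exists_primeFilterRel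
      (y'.coe_nonempty.image f.toHeytingHom) (y'.infClosed_coe.image f.toHeytingHom)
      x.coe_nonempty x.infClosed_coe
      (z'.compl_nonempty.image f.toHeytingHom) (z'.supClosed_compl.image f.toHeytingHom) (by
        rintro _ ⟨a, ha, rfl⟩ c hc _ ⟨b, hb, rfl⟩ hle
        have : f.toFun (layL a b) ∈ x := by
          rw [f.map_layL']
          exact x.mem_of_le ((lay_le_iff_le_layL _ _ _).1 hle) hc
        exact hb (z'.mem_of_le lay_layL_le (hR _ ha _ (hw this))))
    exact ⟨q, p, r, hq, h, fun a ha => hp ⟨a, ha, rfl⟩,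
      fun b hb => by_contra fun hbz => hr _ ⟨b, hbz, rfl⟩ hb⟩

end PrimeFilter

/-! ### Duality for layered Heyting algebras -/

namespace LayHeyAlg

/-- The intuitionistic layered space of prime filters of a layered Heyting algebra. -/
def primeFilterSpace (A : LayHeyAlg.{u}) : IntLaySp.{u} where
  carrier := PrimeFilter A
  R := primeFilterRel
  isClopenUpper_lay C D := by
    obtain ⟨a, rfl⟩ := (PrimeFilter.clopenUpperIso A).surjective C
    obtain ⟨b, rfl⟩ := (PrimeFilter.clopenUpperIso A).surjective D
    refine ⟨?_, fun _ _ h ⟨w, y, z, hw, H⟩ => ⟨w, y, z, hw.trans h, H⟩⟩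
    exact PrimeFilter.frameLay_setOf_mem (a := a) (b := b) ▸
      PrimeFilter.isClopen_setOf_mem (lay a b)
  isClopenUpper_layR C D := by
    obtain ⟨a, rfl⟩ := (PrimeFilter.clopenUpperIso A).surjective C
    obtain ⟨b, rfl⟩ := (PrimeFilter.clopenUpperIso A).surjective D
    refine ⟨?_, fun _ _ h H w y z hw => H w y z (h.trans hw)⟩
    exact PrimeFilter.frameLayR_setOf_mem (a := a) (b := b) ▸
      PrimeFilter.isClopen_setOf_mem (layR a b)
  isClopenUpper_layL C D := by
    obtain ⟨a, rfl⟩ := (PrimeFilter.clopenUpperIso A).surjective C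
    obtain ⟨b, rfl⟩ := (PrimeFilter.clopenUpperIso A).surjective D
    refine ⟨?_, fun _ _ h H w y z hw => H w y z (h.trans hw)⟩
    exact PrimeFilter.frameLayL_setOf_mem (a := a) (b := b) ▸
      PrimeFilter.isClopen_setOf_mem (layL a b)
  exists_separation x y z h := by
    simp only [primeFilterRel, not_forall] at h
    obtain ⟨a, ha, b, hb, hab⟩ := h
    refine ⟨PrimeFilter.clopenUpperIso A a, PrimeFilter.clopenUpperIso A b, ha, hb,
      fun hz => hab ?_⟩
    exact PrimeFilter.frameLay_setOf_mem.subset hz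

/-- The functor sending a layered Heyting algebra to its space of prime filters, and a homomorphism
to the inverse image map. -/
def primeFilter : LayHeyAlg.{u}ᵒᵖ ⥤ IntLaySp.{u} where
  obj A := primeFilterSpace A.unop
  map f := ⟨PrimeFilter.comap (ConcreteCategory.hom (C := LayHeyAlg) f.unop).toHeytingHom,
    (PrimeFilter.comap
      (ConcreteCategory.hom (C := LayHeyAlg) f.unop).toHeytingHom).continuous_toFun,
    PrimeFilter.isLayeredPMorphism_comap (ConcreteCategory.hom (C := LayHeyAlg) f.unop)⟩

/-- An order isomorphism preserving the layering operations is an isomorphism of layered Heyting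
algebras. -/
def isoMk {A B : LayHeyAlg.{u}} (e : A ≃o B) (lay_eq : ∀ a b, e (lay a b) = lay (e a) (e b))
    (layR_eq : ∀ a b, e (layR a b) = layR (e a) (e b))
    (layL_eq : ∀ a b, e (layL a b) = layL (e a) (e b)) : A ≅ B where
  hom := ({ toHeytingHom := (e : HeytingHom A B)
            map_lay' := lay_eq
            map_layR' := layR_eq
            map_layL' := layL_eq } : LayeredHeytingHom A B)
  inv := ({ toHeytingHom := (e.symm : HeytingHom B A)
            map_lay' := fun _ _ => e.injective (by simp [lay_eq])
            map_layR' := fun _ _ => e.injective (by simp [layR_eq])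
            map_layL' := fun _ _ => e.injective (by simp [layL_eq]) } : LayeredHeytingHom B A)
  hom_inv_id := DFunLike.ext (F := LayeredHeytingHom A A) _ _ e.symm_apply_apply
  inv_hom_id := DFunLike.ext (F := LayeredHeytingHom B B) _ _ e.apply_symm_apply

/-- A layered Heyting algebra is isomorphic to the algebra of clopen upper sets of its space of
prime filters. -/
noncomputable def clopenUpperIso (A : LayHeyAlg.{u}) :
    A ≅ IntLaySp.clopenUpper.obj (op (primeFilterSpace A)) :=
  isoMk (B := IntLaySp.clopenUpper.obj (op (primeFilterSpace A))) (PrimeFilter.clopenUpperIso A)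
    (fun _ _ => (SetLike.coe_injective (A := ClopenUpperSet (PrimeFilter A))
      PrimeFilter.frameLay_setOf_mem).symm)
    (fun _ _ => (SetLike.coe_injective (A := ClopenUpperSet (PrimeFilter A))
      PrimeFilter.frameLayR_setOf_mem).symm)
    (fun _ _ => (SetLike.coe_injective (A := ClopenUpperSet (PrimeFilter A))
      PrimeFilter.frameLayL_setOf_mem).symm)

end LayHeyAlg

namespace IntLaySp

theorem isLayeredPMorphism_of_homeomorph {X Y : IntLaySp.{u}} (e : X ≃ₜ Y)
    (h : ∀ x y, e x ≤ e y ↔ x ≤ y) (hR : ∀ x y z, Y.R (e x) (e y) (e z) ↔ X.R x y z) :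
    IsLayeredPMorphism X.R Y.R e where
  monotone _ _ := (h _ _).2
  lift_le x := e.surjective.forall.2 fun y hy => ⟨y, (h _ _).1 hy, rfl⟩
  map_rel _ _ _ := (hR _ _ _).2
  lift_lay x := by
    simp only [e.surjective.forall]
    exact fun w y z hw hR' => ⟨w, y, z, (h _ _).1 hw, (hR _ _ _).1 hR', le_rfl, le_rfl⟩
  lift_layR x := by
    simp only [e.surjective.forall]
    exact fun w y z hw hR' => ⟨w, y, z, (h _ _).1 hw, (hR _ _ _).1 hR', le_rfl, le_rfl⟩
  lift_layL x := by
    simp only [e.surjective.forall]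
    exact fun w y z hw hR' => ⟨w, y, z, (h _ _).1 hw, (hR _ _ _).1 hR', le_rfl, le_rfl⟩

/-- A homeomorphism of intuitionistic layered spaces preserving and reflecting the order and the
ternary relation is an isomorphism. -/
def isoMk {X Y : IntLaySp.{u}} (e : X ≃ₜ Y) (h : ∀ x y, e x ≤ e y ↔ x ≤ y)
    (hR : ∀ x y z, Y.R (e x) (e y) (e z) ↔ X.R x y z) : X ≅ Y where
  hom := ⟨e, e.continuous, isLayeredPMorphism_of_homeomorph e h hR⟩
  inv := ⟨e.symm, e.symm.continuous, isLayeredPMorphism_of_homeomorph e.symm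
    (fun x y => by simp [← h]) (fun x y z => by simp [← hR])⟩
  hom_inv_id := DFunLike.ext (F := Hom X X) _ _ e.symm_apply_apply
  inv_hom_id := DFunLike.ext (F := Hom Y Y) _ _ e.apply_symm_apply

/-- The separation axiom says exactly that `R` is recovered from the operation `▸` on clopen upper
sets. -/
theorem primeFilterRel_toPrimeFilter_iff {X : IntLaySp.{u}} {x y z : X} :
    primeFilterRel (EsakiaSpace.toPrimeFilter x) (EsakiaSpace.toPrimeFilter y)
      (EsakiaSpace.toPrimeFilter z) ↔ X.R x y z := by
  refine ⟨fun h => ?_, fun h C hC D hD => ⟨z, x, y, le_rfl, h, hC, hD⟩⟩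
  by_contra hR
  obtain ⟨C, D, hx, hy, hz⟩ := X.exists_separation x y z hR
  exact hz (h C hx D hy)

/-- An intuitionistic layered space is isomorphic to the space of prime filters of its algebra of
clopen upper sets. -/
noncomputable def primeFilterIso (X : IntLaySp.{u}) :
    X ≅ LayHeyAlg.primeFilterSpace (clopenUpper.obj (op X)) :=
  isoMk (Y := LayHeyAlg.primeFilterSpace (clopenUpper.obj (op X)))
    (EsakiaSpace.primeFilterHomeomorph X)
    (fun _ _ => EsakiaSpace.toPrimeFilter_le_iff)
    (fun _ _ _ => primeFilterRel_toPrimeFilter_iff)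

end IntLaySp

/-- The duality between layered Heyting algebras and intuitionistic layered spaces. Its underlying
functors and natural isomorphisms are those of Esakia duality. -/
noncomputable def LayHeyAlg.layeredDuality : LayHeyAlg.{u}ᵒᵖ ≌ IntLaySp.{u} :=
  .mk LayHeyAlg.primeFilter IntLaySp.clopenUpper.rightOp
    (NatIso.ofComponents (F := LayHeyAlg.primeFilter ⋙ IntLaySp.clopenUpper.rightOp) (G := 𝟭 _)
      (fun A => (LayHeyAlg.clopenUpperIso A.unop).op) (fun _ => rfl)).symm
    (NatIso.ofComponents (F := 𝟭 _) (G := IntLaySp.clopenUpper.rightOp ⋙ LayHeyAlg.primeFilter)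
      (fun X => IntLaySp.primeFilterIso X) (fun _ => rfl)).symm

theorem mainTheorem6 :
    ∃ (D : LayHeyAlg.{u}ᵒᵖ ≌ IntLaySp.{u}) (E : HeytAlg.{u}ᵒᵖ ≌ EsakiaSp.{u}),
      (Nonempty (LayeredPrimeFilterPresentation D.functor) ∧
        D.inverse = IntLaySp.clopenUpper.rightOp) ∧
      (Nonempty (PrimeFilterPresentation E.functor) ∧
        E.inverse = EsakiaSp.clopenUpper.rightOp) ∧
      Nonempty (D.functor ⋙ IntLaySp.toEsakiaSp ≅ LayHeyAlg.toHeytAlg.op ⋙ E.functor) ∧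
      IntLaySp.clopenUpper.{u} ⋙ LayHeyAlg.toHeytAlg =
        IntLaySp.toEsakiaSp.op ⋙ EsakiaSp.clopenUpper := by
  refine ⟨LayHeyAlg.layeredDuality, HeytAlg.esakiaDuality, ⟨⟨?_⟩, rfl⟩, ⟨⟨?_⟩, rfl⟩, ⟨?_⟩, rfl⟩
  · exact ⟨fun A => Homeomorph.refl (PrimeFilter A), fun _ _ _ => Iff.rfl,
      fun _ _ _ _ => Iff.rfl, fun _ _ _ _ _ => Iff.rfl⟩
  · exact ⟨fun A => Homeomorph.refl (PrimeFilter A), fun _ _ _ => Iff.rfl,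
      fun _ _ _ _ _ => Iff.rfl⟩
  · exact Iso.refl _
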